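/- Let $X$ be a compact metrizable space and let $P(X)$ be the (compact metrizable) space of Borel probability measures on $X$ with the weak topology. For $A\subseteq X$ and $\mu\in P(X)$ put $\mu^*(A)=\inf\{\mu(B): A\subseteq B\subseteq X,\ B\text{ Borel}\}$, and let $$P_\tau(A)=\{\mu\in P(X): \mu^*(A)=1\}\subseteq P(X),$$ which is the standard realization inside $P(X)$ of the space of $\tau$-smooth probability measures on $A$. For a compact metrizable space $Y$, the family $\mathcal P(Y)$ of projective subsets of $Y$ is the smallest family of subsets of $Y$ that contains all Borel sets, contains $Y\setminus A$ whenever it contains $A$, and contains $f(A)$ whenever it contains $A$ and $f:A\to Y$ is continuous. The classes $\mathcal P_k(Y)$, $k\ge 0$, are defined as follows: $\mathcal P_0(Y)$ is the family of Borel subsets of $Y$; for $m\ge 0$, $\mathcal P_{2m+1}(Y)$ consists of the images $f(A)\subseteq Y$ of sets $A\in\mathcal P_{2m}(Y)$ under continuous maps $f:A\to Y$, and $\mathcal P_{2m+2}(Y)$ consists of the complements $Y\setminus A$ of sets $A\in\mathcal P_{2m+1}(Y)$. **Theorem 1.23.** The functor $P_\tau$ preserves projective subsets of metrizable compacta: for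 every compact metrizable space $X$, if $A\in\mathcal P(X)$, then $P_\tau(A)\in\mathcal P(P(X))$. Moreover, for every compact metrizable space $X$ and every integer $n\ge 1$, if $A\in\mathcal P_{2n-1}(X)$, then $P_\tau(A)\in\mathcal P_{2n+2}(P(X))$. -/

import Mathlib

open MeasureTheory

/-- The projective subsets of a space `X`: the smallest family of subsets of `X` that contains
the Borel sets, contains the image of `f : A → X` whenever it contains `A` and `f` is continuous,
and is closed under complements. -/
inductive IsProjectiveSet {X : Type*} [TopologicalSpace X] : Set X → Prop
  | borel (A : Set X) (hA : MeasurableSet[borel X] A) : IsProjectiveSet A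
  | image (A : Set X) (hA : IsProjectiveSet A) (f : A → X) (hf : Continuous f) :
      IsProjectiveSet (Set.range f)
  | compl (A : Set X) (hA : IsProjectiveSet A) : IsProjectiveSet Aᶜ

/-- The projective class of index `k` on `X`. Class `0` consists of the Borel sets, class `2m + 1`
of the images `f(A) ⊆ X` of sets `A` of class `2m` under continuous maps `f : A → X`, and class
`2m + 2` of the complements of the sets of class `2m + 1`. -/
def projectiveClass (X : Type*) [TopologicalSpace X] : ℕ → Set (Set X)
  | 0 => {A | MeasurableSet[borel X] A}
  | k + 1 =>
    if Even k then
      {B | ∃ A ∈ projectiveClass X k, ∃ f : A → X, Continuous f ∧ Set.range f = B}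
    else
      {B | ∃ A ∈ projectiveClass X k, B = Aᶜ}

/-- The outer measure `μ^*(A)`, the infimum of `μ(B)` over the Borel sets `B ⊇ A`. -/
noncomputable def upperMeasure {X : Type*} [MeasurableSpace X] (μ : ProbabilityMeasure X)
    (A : Set X) : ENNReal :=
  ⨅ (B : Set X) (_ : A ⊆ B) (_ : MeasurableSet B), (μ : Measure X) B

/-- For a subset `A` of a compact metrizable space `X`, the space `P_τ(A)` of `τ`-smooth
probability measures on `A`, as the subset `{μ | μ^*(A) = 1}` of the space `P(X)` of Borel
probability measures on `X`, which carries the weak topology. -/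
def tauSmoothMeasures {X : Type*} [MeasurableSpace X] (A : Set X) :
    Set (ProbabilityMeasure X) :=
  {μ | upperMeasure μ A = 1}

open TopologicalSpace Set

universe u v w

/-! By inner regularity, `μ^*(A) ≠ 1` exactly when a closed set `K` of positive `μ`-measure misses
`A` (`upperMeasure_ne_one_iff`). Closed sets are coded by points of a Cantor cube; `μ(K) = 0` is a
Borel condition on `μ` and the code, and "`K` meets `A`" is `Σ¹ₙ` when `A` is. Projecting away the
code makes the complement of `P_τ(A)` a `Σ¹ₙ₊₁` set. Projections along the Cantor space make sense
over any measurable space; on compact metrizable spaces they yield the given projective classes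
(`range_of_compl`, `exists_range_eq`). -/

/-- **Hausdorff–Alexandroff theorem** for compact metrizable spaces. -/
theorem exists_nat_bool_continuous_surjective_of_metrizable (Y : Type u) [Nonempty Y]
    [TopologicalSpace Y] [CompactSpace Y] [MetrizableSpace Y] :
    ∃ f : (ℕ → Bool) → Y, Continuous f ∧ f.Surjective :=
  let _ : MetricSpace Y := metrizableSpaceMetric Y
  exists_nat_bool_continuous_surjective_of_compact Y

/-! ### The projection hierarchy on measurable spaces -/

/-- The class `Σ¹ₙ` of subsets of a measurable space: `Σ¹₀` consists of the measurable sets, and the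
sets in `Σ¹ₙ₊₁` are the projections along the Cantor space of complements of sets in `Σ¹ₙ`. -/
def IsSigmaOne : ℕ → ∀ {Y : Type u} [MeasurableSpace Y], Set Y → Prop
  | 0, _, _, A => MeasurableSet A
  | n + 1, Y, _, A => ∃ B : Set (Y × (ℕ → Bool)), IsSigmaOne n Bᶜ ∧ Prod.fst '' B = A

namespace IsSigmaOne

section Measurable

variable {Y : Type u} {Z : Type v} {W : Type w} [MeasurableSpace Y] [MeasurableSpace Z]
  [MeasurableSpace W] {n : ℕ}

theorem preimage {A : Set Y} (hA : IsSigmaOne n A) {g : Z → Y} (hg : Measurable g) :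
    IsSigmaOne n (g ⁻¹' A) := by
  induction n generalizing Y Z with
  | zero => exact hg hA
  | succ n ih =>
    obtain ⟨B, hB, rfl⟩ := hA
    refine ⟨Prod.map g id ⁻¹' B, ih hB (hg.prodMap measurable_id), ?_⟩
    ext z
    simp

theorem of_measurableSet {A : Set Y} (hA : MeasurableSet A) : IsSigmaOne n A := by
  induction n generalizing Y with
  | zero => exact hA
  | succ n ih =>
    refine ⟨Prod.fst ⁻¹' A, ih (measurable_fst hA).compl, ?_⟩
    ext y
    simp

theorem succ_of_compl {A : Set Y} (hA : IsSigmaOne n Aᶜ) : IsSigmaOne (n + 1) A :=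
  ⟨Prod.fst ⁻¹' A, hA.preimage measurable_fst, by ext y; simp⟩

/-- Complementation swaps the two claims, so the induction needs both. -/
theorem union_inter_measurableSet {A M : Set Y} (hA : IsSigmaOne n A) (hM : MeasurableSet M) :
    IsSigmaOne n (A ∪ M) ∧ IsSigmaOne n (A ∩ M) := by
  induction n generalizing Y with
  | zero => exact ⟨MeasurableSet.union hA hM, MeasurableSet.inter hA hM⟩
  | succ n ih =>
    obtain ⟨B, hB, rfl⟩ := hA
    have h := ih hB (measurable_fst hM).compl
    refine ⟨⟨B ∪ Prod.fst ⁻¹' M, by rw [compl_union]; exact h.2, ?_⟩,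
      ⟨B ∩ Prod.fst ⁻¹' M, by rw [compl_inter]; exact h.1, ?_⟩⟩
    · rw [image_union, image_preimage_eq _ Prod.fst_surjective]
    · rw [image_inter_preimage]

theorem union_measurableSet {A M : Set Y} (hA : IsSigmaOne n A) (hM : MeasurableSet M) :
    IsSigmaOne n (A ∪ M) :=
  (hA.union_inter_measurableSet hM).1

theorem inter_measurableSet {A M : Set Y} (hA : IsSigmaOne n A) (hM : MeasurableSet M) :
    IsSigmaOne n (A ∩ M) :=
  (hA.union_inter_measurableSet hM).2

theorem image_fst_of_compl {s : (ℕ → Bool) → W} (hs : Measurable s) (hs' : s.Surjective)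
    {B : Set (Y × W)} (hB : IsSigmaOne n Bᶜ) : IsSigmaOne (n + 1) (Prod.fst '' B) := by
  refine ⟨Prod.map id s ⁻¹' B, hB.preimage (measurable_id.prodMap hs), ?_⟩
  ext y
  simp [hs'.exists]

theorem image_fst_cantor {B : Set (Y × (ℕ → Bool))} (hB : IsSigmaOne (n + 1) B) :
    IsSigmaOne (n + 1) (Prod.fst '' B) := by
  obtain ⟨C, hC, rfl⟩ := hB
  -- Two Cantor witnesses merge into one.
  obtain ⟨s, hs, hs'⟩ := exists_nat_bool_continuous_surjective_of_metrizable ((ℕ → Bool) × (ℕ → Bool))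
  have h : IsSigmaOne n ((fun p : Y × (ℕ → Bool) × (ℕ → Bool) ↦ ((p.1, p.2.1), p.2.2)) ⁻¹' C)ᶜ :=
    hC.preimage (by fun_prop)
  convert image_fst_of_compl hs.measurable hs' h
  ext y
  simp

theorem image_fst {s : (ℕ → Bool) → W} (hs : Measurable s) (hs' : s.Surjective)
    {B : Set (Y × W)} (hB : IsSigmaOne (n + 1) B) : IsSigmaOne (n + 1) (Prod.fst '' B) := by
  convert image_fst_cantor (hB.preimage (measurable_id.prodMap hs))
  ext y
  simp [hs'.exists]

theorem of_countable [Countable Y] [MeasurableSingletonClass Y] (A : Set Y) : IsSigmaOne n A :=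
  of_measurableSet A.to_countable.measurableSet

end Measurable

/-! ### Projections versus continuous images -/

section Compact

variable {Y : Type u} [TopologicalSpace Y] [CompactSpace Y] [MetrizableSpace Y] [MeasurableSpace Y]
  [BorelSpace Y] {n : ℕ}

/-- A continuous image of a set in `Π¹ₙ` is in `Σ¹ₙ₊₁`. -/
theorem range_of_compl {A : Set Y} (hA : IsSigmaOne n Aᶜ) {f : A → Y} (hf : Continuous f) :
    IsSigmaOne (n + 1) (range f) := by
  cases isEmpty_or_nonempty Y with
  | inl _ => exact of_countable _
  | inr _ =>
    have hgraph : IsClosed {p : Y × A | f p.2 = p.1} :=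
      isClosed_eq (hf.comp continuous_snd) continuous_fst
    have hind : Topology.IsInducing (Prod.map id Subtype.val : Y × A → Y × Y) :=
      Topology.IsInducing.id.prodMap Topology.IsInducing.subtypeVal
    -- The graph is closed only relative to `Y × A`; it is the trace of a closed `F ⊆ Y × Y`, so the
    -- range is the projection of `F ∩ (Y × A)`.
    obtain ⟨F, hF, hFA⟩ := hind.isClosed_iff.1 hgraph
    obtain ⟨s, hs, hs'⟩ := exists_nat_bool_continuous_surjective_of_metrizable Y
    have h : IsSigmaOne n (F ∩ Prod.snd ⁻¹' A)ᶜ := by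
      rw [compl_inter, union_comm]
      exact (hA.preimage measurable_snd).union_measurableSet hF.measurableSet.compl
    convert image_fst_of_compl hs.measurable hs' h
    ext y
    have hiff (a : A) : (y, (a : Y)) ∈ F ↔ f a = y := Set.ext_iff.1 hFA (y, a)
    constructor
    · rintro ⟨a, rfl⟩
      exact ⟨(f a, a), ⟨(hiff a).2 rfl, a.2⟩, rfl⟩
    · rintro ⟨⟨_, a⟩, ⟨h1, h2⟩, rfl⟩
      exact ⟨⟨a, h2⟩, (hiff ⟨a, h2⟩).1 h1⟩

/-- Every set in `Σ¹ₙ₊₁` is a continuous image of a set in `Π¹ₙ` of the same space. -/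
theorem exists_range_eq {A : Set Y} (hA : IsSigmaOne (n + 1) A) :
    ∃ B : Set Y, IsSigmaOne n Bᶜ ∧ ∃ f : B → Y, Continuous f ∧ range f = A := by
  by_cases hY : Countable Y
  · exact ⟨A, of_countable _, Subtype.val, continuous_subtype_val, Subtype.range_coe⟩
  · have : Nonempty Y := by
      by_contra h
      rw [not_nonempty_iff] at h
      exact hY inferInstance
    let _ : MetricSpace Y := metrizableSpaceMetric Y
    -- An uncountable `Y` contains a Cantor set, which has room for a copy of the witness set `C`,
    -- pulled back along `s`.
    obtain ⟨i, -, hi, hinj⟩ := (isClosed_univ (X := Y)).exists_nat_bool_injection_of_not_countable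
      (by rwa [countable_univ_iff])
    obtain ⟨C, hC, rfl⟩ := hA
    obtain ⟨s, hs, hs'⟩ := exists_nat_bool_continuous_surjective_of_metrizable (Y × (ℕ → Bool))
    have hemb : Topology.IsClosedEmbedding i := hi.isClosedEmbedding hinj
    have hmeas : MeasurableEmbedding i := hemb.measurableEmbedding
    let e := hemb.isEmbedding.toHomeomorph
    have hB : i '' (s ⁻¹' C) = range i ∩ hmeas.invFun ⁻¹' (s ⁻¹' C) := by
      ext y
      constructor
      · rintro ⟨x, hx, rfl⟩
        exact ⟨⟨x, rfl⟩, by rwa [mem_preimage, hmeas.leftInverse_invFun]⟩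
      · rintro ⟨⟨x, rfl⟩, hx⟩
        rw [mem_preimage, hmeas.leftInverse_invFun] at hx
        exact ⟨x, hx, rfl⟩
    refine ⟨i '' (s ⁻¹' C), ?_, fun y ↦ (s (e.symm ⟨y, image_subset_range _ _ y.2⟩)).1, ?_, ?_⟩
    · rw [hB, compl_inter, union_comm]
      exact ((hC.preimage hs.measurable).preimage hmeas.measurable_invFun).union_measurableSet
        hmeas.measurableSet_range.compl
    · fun_prop
    · have he (x : ℕ → Bool) (h : i x ∈ range i) : e.symm ⟨i x, h⟩ = x :=
        e.symm_apply_eq.2 rfl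
      ext y
      constructor
      · rintro ⟨⟨_, x, hx, rfl⟩, rfl⟩
        exact ⟨s x, hx, by simp only [he]⟩
      · rintro ⟨p, hp, rfl⟩
        obtain ⟨x, rfl⟩ := hs' p
        exact ⟨⟨i x, x, hp, rfl⟩, by simp only [he]⟩

end Compact

end IsSigmaOne

/-! ### Comparison with the projective classes -/

section Classes

variable {Y : Type u} [TopologicalSpace Y]

theorem mem_projectiveClass_odd {m : ℕ} {B : Set Y} : B ∈ projectiveClass Y (2 * m + 1) ↔
    ∃ A ∈ projectiveClass Y (2 * m), ∃ f : A → Y, Continuous f ∧ range f = B := by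
  rw [projectiveClass, if_pos (even_two_mul m)]
  rfl

theorem mem_projectiveClass_even_add_two {m : ℕ} {B : Set Y} :
    B ∈ projectiveClass Y (2 * m + 2) ↔ Bᶜ ∈ projectiveClass Y (2 * m + 1) := by
  rw [projectiveClass, if_neg (by simp [parity_simps])]
  constructor
  · rintro ⟨A, hA, rfl⟩
    rwa [compl_compl]
  · exact fun h ↦ ⟨Bᶜ, h, (compl_compl B).symm⟩

theorem isProjectiveSet_of_mem_projectiveClass {k : ℕ} {A : Set Y}
    (hA : A ∈ projectiveClass Y k) : IsProjectiveSet A := by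
  induction k generalizing A with
  | zero => exact .borel A hA
  | succ k ih =>
    rw [projectiveClass] at hA
    split_ifs at hA
    · obtain ⟨B, hB, f, hf, rfl⟩ := hA
      exact .image B (ih hB) f hf
    · obtain ⟨B, hB, rfl⟩ := hA
      exact .compl B (ih hB)

variable [CompactSpace Y] [MetrizableSpace Y] [MeasurableSpace Y] [BorelSpace Y]

theorem mem_projectiveClass_even_iff {m : ℕ} {A : Set Y} :
    A ∈ projectiveClass Y (2 * m) ↔ IsSigmaOne m Aᶜ := by
  induction m generalizing A with
  | zero =>
    change MeasurableSet[borel Y] A ↔ MeasurableSet Aᶜ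
    rw [← BorelSpace.measurable_eq (α := Y), MeasurableSet.compl_iff]
  | succ m ih =>
    rw [Nat.mul_succ, mem_projectiveClass_even_add_two, mem_projectiveClass_odd]
    simp only [ih]
    constructor
    · rintro ⟨B, hB, f, hf, hfA⟩
      exact hfA ▸ hB.range_of_compl hf
    · exact IsSigmaOne.exists_range_eq

theorem mem_projectiveClass_odd_iff {m : ℕ} {A : Set Y} :
    A ∈ projectiveClass Y (2 * m + 1) ↔ IsSigmaOne (m + 1) A := by
  rw [← compl_compl A, ← mem_projectiveClass_even_add_two, ← mem_projectiveClass_even_iff]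
  rfl

theorem IsProjectiveSet.exists_isSigmaOne {A : Set Y} (hA : IsProjectiveSet A) :
    ∃ n, IsSigmaOne (n + 1) A := by
  induction hA with
  | borel A hA =>
    rw [← BorelSpace.measurable_eq (α := Y)] at hA
    exact ⟨0, .of_measurableSet hA⟩
  | image A _ f hf ih =>
    obtain ⟨n, hn⟩ := ih
    -- One level is spent on complementing `A`, one on the image.
    refine ⟨n + 2, IsSigmaOne.range_of_compl (IsSigmaOne.succ_of_compl ?_) hf⟩
    rwa [compl_compl]
  | compl A _ ih =>
    obtain ⟨n, hn⟩ := ih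
    exact ⟨n + 1, IsSigmaOne.succ_of_compl (by rwa [compl_compl])⟩

end Classes

/-! ### Complexity of `P_τ(A)` -/

section TauSmooth

variable {X : Type u} [TopologicalSpace X] [CompactSpace X] [MetrizableSpace X] [MeasurableSpace X]
  [BorelSpace X]

-- Closed sets form a generating π-system, and `μ(F)` is a limit of integrals of continuous
-- functions, each weakly continuous in `μ`.
omit [CompactSpace X] in
theorem measurable_probabilityMeasure_borel :
    @Measurable _ _ (borel (ProbabilityMeasure X)) Measure.instMeasurableSpace
      (fun μ : ProbabilityMeasure X ↦ (μ : Measure X)) := by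
  let _ : MetricSpace X := metrizableSpaceMetric X
  let _ : MeasurableSpace (ProbabilityMeasure X) := borel _
  have : BorelSpace (ProbabilityMeasure X) := ⟨rfl⟩
  refine Measurable.measure_of_isPiSystem_of_isProbabilityMeasure
    ((BorelSpace.measurable_eq (α := X)).trans borel_eq_generateFrom_isClosed) isPiSystem_isClosed
    fun F hF ↦ ?_
  refine measurable_of_tendsto_metrizable (f := fun n (μ : ProbabilityMeasure X) ↦
    ∫⁻ x, (hF.apprSeq n x : ENNReal) ∂(μ : Measure X)) (fun n ↦ ?_) ?_
  · exact (ProbabilityMeasure.continuous_lintegral_boundedContinuousFunction _).measurable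
  · rw [tendsto_pi_nhds]
    exact fun μ ↦ HasOuterApproxClosed.tendsto_lintegral_apprSeq hF _

theorem upperMeasure_ne_one_iff {μ : ProbabilityMeasure X} {A : Set X} :
    upperMeasure μ A ≠ 1 ↔ ∃ K, IsClosed K ∧ (μ : Measure X) K ≠ 0 ∧ Disjoint K A := by
  constructor
  · intro h
    have hle : upperMeasure μ A ≤ 1 :=
      (iInf₂_le univ (subset_univ A)).trans ((iInf_le _ .univ).trans (by simp))
    have hlt := hle.lt_of_ne h
    simp only [upperMeasure, iInf_lt_iff] at hlt
    obtain ⟨B, hAB, hB, hlt⟩ := hlt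
    have hpos : 0 < (μ : Measure X) Bᶜ := by
      rw [prob_compl_eq_one_sub hB]
      exact tsub_pos_of_lt hlt
    obtain ⟨K, hKB, hK, hKpos⟩ := hB.compl.exists_lt_isClosed_of_ne_top (by simp) hpos
    exact ⟨K, hK, hKpos.ne', (disjoint_compl_left.mono_left hKB).mono_right hAB⟩
  · rintro ⟨K, hK, hKpos, hKA⟩ h
    have hle : upperMeasure μ A ≤ (μ : Measure X) Kᶜ :=
      (iInf₂_le Kᶜ hKA.subset_compl_left).trans (iInf_le _ hK.measurableSet.compl)
    rw [h, prob_compl_eq_one_sub hK.measurableSet] at hle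
    exact (ENNReal.sub_lt_self (by simp) one_ne_zero hKpos).not_ge hle

variable (X) in
/-- The closed sets, coded by points of a Cantor cube: `x` codes the complement of the union of the
basic open sets that it selects. -/
def closedCode : Set (X × (countableBasis X → Bool)) :=
  {p | ∀ i : countableBasis X, p.2 i = true → p.1 ∉ (i : Set X)}

theorem measurableSet_closedCode : MeasurableSet (closedCode X) := by
  have : closedCode X = ⋂ i : countableBasis X,
      ({p : X × (countableBasis X → Bool) | p.2 i = true} ∩ Prod.fst ⁻¹' (i : Set X))ᶜ := by
    ext p
    simp [closedCode]
  rw [this]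
  refine .iInter fun i ↦ (MeasurableSet.inter ?_ ?_).compl
  · exact measurableSet_eq_fun (by fun_prop) measurable_const
  · exact measurable_fst (isOpen_of_mem_countableBasis i.2).measurableSet

omit [MeasurableSpace X] [BorelSpace X] in
theorem isClosed_iff_exists_closedCode {K : Set X} :
    IsClosed K ↔ ∃ x, (fun p ↦ (p, x)) ⁻¹' closedCode X = K := by
  classical
  constructor
  · intro hK
    -- The code selects every basic open set disjoint from `K`.
    refine ⟨fun i ↦ decide (Disjoint (i : Set X) K), ?_⟩
    ext p
    simp only [closedCode, mem_preimage, mem_ofPred_eq, decide_eq_true_eq]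
    constructor
    · intro h
      by_contra hp
      obtain ⟨V, hV, hpV, hVK⟩ := (isBasis_countableBasis X).exists_subset_of_mem_open
        (mem_compl hp) hK.isOpen_compl
      exact h ⟨V, hV⟩ (disjoint_compl_left.mono_left hVK) hpV
    · exact fun hp i hi hpi ↦ disjoint_left.1 hi hpi hp
  · rintro ⟨x, rfl⟩
    have : (fun p ↦ (p, x)) ⁻¹' closedCode X =
        ⋂ i : countableBasis X, ⋂ _ : x i = true, (i : Set X)ᶜ := by
      ext p
      simp [closedCode]
    rw [this]
    exact isClosed_iInter fun i ↦ isClosed_iInter fun _ ↦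
      (isOpen_of_mem_countableBasis i.2).isClosed_compl

/-- If `A` is in `Σ¹ₙ₊₁`, then being a measure whose upper measure at `A` is not `1` is a `Σ¹ₙ₊₂`
property: it is witnessed by a closed set of positive measure that misses `A`. -/
theorem IsSigmaOne.setOf_upperMeasure_ne_one {T : Type v} [MeasurableSpace T]
    {ν : T → ProbabilityMeasure X} (hν : Measurable fun t ↦ (ν t : Measure X)) {n : ℕ} {A : Set X}
    (hA : IsSigmaOne (n + 1) A) : IsSigmaOne (n + 2) {t | upperMeasure (ν t) A ≠ 1} := by
  cases isEmpty_or_nonempty X with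
  | inl _ =>
    have : IsEmpty T := ⟨fun t ↦ (ν t).nonempty.elim isEmptyElim⟩
    exact of_measurableSet (by rw [eq_empty_of_isEmpty {t | _}]; exact .empty)
  | inr _ =>
    obtain ⟨s, hs, hs'⟩ := exists_nat_bool_continuous_surjective_of_metrizable X
    obtain ⟨r, hr, hr'⟩ := exists_nat_bool_continuous_surjective_of_metrizable
      (countableBasis X → Bool)
    let codedSet (x : countableBasis X → Bool) : Set X := (fun p ↦ (p, x)) ⁻¹' closedCode X
    have hmeas : MeasurableSet {q : T × (countableBasis X → Bool) |
        (ν q.1 : Measure X) (codedSet q.2) = 0} := by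
      -- As a kernel, `ν` measures the sections of a measurable set measurably.
      let κ : ProbabilityTheory.Kernel (T × (countableBasis X → Bool)) X :=
        ⟨fun q ↦ (ν q.1 : Measure X), hν.comp measurable_fst⟩
      have : ProbabilityTheory.IsMarkovKernel κ :=
        ⟨fun q ↦ inferInstanceAs (IsProbabilityMeasure (ν q.1 : Measure X))⟩
      have hS : MeasurableSet {p : (T × (countableBasis X → Bool)) × X |
          (p.2, p.1.2) ∈ closedCode X} :=
        measurableSet_closedCode.preimage (by fun_prop)
      exact measurableSet_eq_fun (ProbabilityTheory.Kernel.measurable_kernel_prodMk_left (κ := κ) hS)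
        measurable_const
    have hmeet : IsSigmaOne (n + 1) {q : T × (countableBasis X → Bool) |
        ¬ Disjoint (codedSet q.2) A} := by
      have h : IsSigmaOne (n + 1) (Prod.snd ⁻¹' A ∩
          {p : (T × (countableBasis X → Bool)) × X | (p.2, p.1.2) ∈ closedCode X}) :=
        (hA.preimage measurable_snd).inter_measurableSet
          (measurableSet_closedCode.preimage (by fun_prop))
      convert image_fst hs.measurable hs' h
      ext q
      simp only [not_disjoint_iff, codedSet, mem_ofPred_eq, mem_image, mem_inter_iff, mem_preimage]
      constructor
      · rintro ⟨p, hp, hpA⟩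
        exact ⟨(q, p), ⟨hpA, hp⟩, rfl⟩
      · rintro ⟨⟨_, p⟩, ⟨hpA, hp⟩, rfl⟩
        exact ⟨p, hp, hpA⟩
    have h : IsSigmaOne (n + 1) {q : T × (countableBasis X → Bool) |
        (ν q.1 : Measure X) (codedSet q.2) ≠ 0 ∧ Disjoint (codedSet q.2) A}ᶜ := by
      convert hmeet.union_measurableSet hmeas using 1
      ext q
      simp only [mem_compl_iff, mem_ofPred_eq, mem_union]
      tauto
    convert image_fst_of_compl hr.measurable hr' h
    ext t
    simp only [upperMeasure_ne_one_iff, isClosed_iff_exists_closedCode, mem_ofPred_eq, mem_image,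
      Prod.exists, exists_and_right, exists_eq_right]
    constructor
    · rintro ⟨_, ⟨x, rfl⟩, h⟩
      exact ⟨x, h⟩
    · rintro ⟨x, h⟩
      exact ⟨_, ⟨x, rfl⟩, h⟩

theorem tauSmoothMeasures_mem_projectiveClass {n : ℕ} {A : Set X} (hA : IsSigmaOne (n + 1) A) :
    tauSmoothMeasures A ∈ projectiveClass (ProbabilityMeasure X) (2 * (n + 2)) := by
  let _ : MeasurableSpace (ProbabilityMeasure X) := borel _
  have : BorelSpace (ProbabilityMeasure X) := ⟨rfl⟩
  exact mem_projectiveClass_even_iff.2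
    (hA.setOf_upperMeasure_ne_one measurable_probabilityMeasure_borel)

end TauSmooth

theorem theorem1p23 {X : Type*} [TopologicalSpace X] [CompactSpace X]
    [TopologicalSpace.MetrizableSpace X] [MeasurableSpace X] [BorelSpace X] :
    (∀ A : Set X, IsProjectiveSet A → IsProjectiveSet (tauSmoothMeasures A)) ∧
    (∀ n : ℕ, 1 ≤ n → ∀ A ∈ projectiveClass X (2 * n - 1),
      tauSmoothMeasures A ∈ projectiveClass (ProbabilityMeasure X) (2 * n + 2)) := by
  refine ⟨fun A hA ↦ ?_, fun n hn A hA ↦ ?_⟩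
  · obtain ⟨n, hn⟩ := hA.exists_isSigmaOne
    exact isProjectiveSet_of_mem_projectiveClass (tauSmoothMeasures_mem_projectiveClass hn)
  · obtain ⟨m, rfl⟩ := Nat.exists_eq_add_of_le' hn
    -- With `n = m + 1`, the indices `2 * n - 1` and `2 * n + 2` reduce to `2 * m + 1` and `2 * (m +
    -- 2)`.
    exact tauSmoothMeasures_mem_projectiveClass (mem_projectiveClass_odd_iff.1 hA)
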